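/- Let $(M,g)$ be a smooth Riemannian manifold and let $(N,h,J)$ be a Kähler manifold, i.e. $h$ is a Riemannian metric on $N$, $J$ is a smooth field of endomorphisms of $TN$ with $J^2=-\mathrm{Id}$ and $h(JX,JY)=h(X,Y)$, and $\nabla J=0$ for the Levi-Civita connection of $h$ (manifolds are finite-dimensional and without boundary). Let $\phi:M\to N$ be a non-constant smooth map which is pseudo horizontally weakly conformal, i.e. $$[d\phi\circ(d\phi)^*,J]=0, \tag{PHWC}$$ where $(d\phi_x)^*:T_{\phi(x)}N\to T_xM$ denotes the adjoint of $d\phi_x$ with respect to $g$ and $h$. By (PHWC), for every $x\in M$ there is exactly one $g$-skew-symmetric endomorphism $F^\phi_x$ of $T_xM$ with $(F^\phi_x)^3+F^\phi_x=0$ such that $$\{\omega\in T_x^*M\otimes\mathbb{C} : \omega\circ F^\phi_x=i\,\omega\}=\{\alpha\circ d\phi_x : \alpha\in T^{(1,0)*}_{\phi(x)}N\},\qquad T^{(1,0)*}_{y}N=\{\alpha\in T_y^*N\otimes\mathbb{C} : \alpha\circ J=i\,\alpha\}.$$ Suppose that $F^\phi$ is an f-structure on $(M,g)$, i.e. that this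 skew-symmetric field of endomorphisms with $(F^\phi)^3+F^\phi=0$ is smooth, and that it is parallel: $\nabla F^\phi=0$ for the Levi-Civita connection of $g$. Then $\phi$ is harmonic, i.e. its tension field $\tau(\phi)=\operatorname{tr}_g\nabla d\phi$ vanishes identically. -/

import Mathlib

open Set Filter Topology Bundle
open scoped Manifold ContDiff

namespace PHWC

/-! ### Linear algebra in a fibre -/

section LinearAlgebra

variable {V W : Type*} [AddCommGroup V] [Module ℝ V] [AddCommGroup W] [Module ℝ W]

/-- The `+i`-eigenspace of a real endomorphism `F` of `V`, acting by transposition on the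
complexified dual `V* ⊗ ℂ`, whose elements are the real-linear maps `V → ℂ`.  For an almost complex
structure this is the space of covectors of type `(1,0)`, for an f-structure it is the space of
covectors of type `+`. -/
def plusCovectors (F : V →ₗ[ℝ] V) : Set (V →ₗ[ℝ] ℂ) :=
  {θ | ∀ v, θ (F v) = Complex.I * θ v}

/-- `F` is an f-structure on the vector space `V` with scalar product `g`:
it is skew-symmetric and `F³ + F = 0`. -/
structure IsFStructureAt (g : V →ₗ[ℝ] V →ₗ[ℝ] ℝ) (F : V →ₗ[ℝ] V) : Prop where
  skew : ∀ v w, g (F v) w = -g v (F w)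
  cube : ∀ v, F (F (F v)) + F v = 0

/-- `F` is the f-structure on `(V, g)` whose space of covectors of type `+` is the
pull-back by `A : V → W` of the space of `(1,0)`-covectors of `(W, J)`. -/
structure IsAssociatedAt (g : V →ₗ[ℝ] V →ₗ[ℝ] ℝ) (J : W →ₗ[ℝ] W) (A : V →ₗ[ℝ] W)
    (F : V →ₗ[ℝ] V) : Prop extends IsFStructureAt g F where
  plus : plusCovectors F = {θ | ∃ α ∈ plusCovectors J, θ = α ∘ₗ A}

/-- An f-structure on a vector space with a scalar product is determined by its covectors of
type `+`. -/
theorem IsFStructureAt.eq_of_plus {g : V →ₗ[ℝ] V →ₗ[ℝ] ℝ}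
    (gpos : ∀ v, v ≠ 0 → 0 < g v v)
    {F F' : V →ₗ[ℝ] V} (hF : IsFStructureAt g F) (hF' : IsFStructureAt g F')
    (h : plusCovectors F' = plusCovectors F) : F' = F := by
  have nondeg : ∀ u v : V, (∀ z, g z u = g z v) → u = v := by
    intro u v huv
    by_contra hne
    have h1 := gpos (u - v) (sub_ne_zero.2 hne)
    have h2 := huv (u - v)
    rw [map_sub, h2, sub_self] at h1
    exact lt_irrefl _ h1
  -- the key identity: `P' F' F = F'^2` when the covectors of type `+` of `P'` are those of `P`
  have key : ∀ P P' : V →ₗ[ℝ] V, IsFStructureAt g P → IsFStructureAt g P' →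
      plusCovectors P' = plusCovectors P →
      ∀ v, P' (P v) = P' (P' v) ∧ P' (P' (P v)) = - P' v := by
    intro P P' hP hP' hPP
    have aux : ∀ z v, g z (P' (P v)) = g z (P' (P' v)) ∧
        g z (P' (P' (P v))) = - g z (P' v) := by
      intro z v
      let ξ : V →ₗ[ℝ] ℝ := g z
      let θ : V →ₗ[ℝ] ℂ := Complex.ofRealCLM.toLinearMap ∘ₗ (ξ ∘ₗ P' ∘ₗ P') +
        Complex.I • (Complex.ofRealCLM.toLinearMap ∘ₗ (ξ ∘ₗ P'))
      have hθ : ∀ u, θ u = (g z (P' (P' u)) : ℂ) + Complex.I * (g z (P' u) : ℂ) := by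
        intro u; simp [θ, ξ]
      have mem : θ ∈ plusCovectors P' := by
        intro u
        have : g z (P' (P' (P' u))) = - g z (P' u) := by
          rw [← map_neg, eq_neg_of_add_eq_zero_left (hP'.cube u)]
        rw [hθ, hθ, this]
        push_cast
        linear_combination (-(g z (P' u)) : ℂ) * Complex.I_mul_I
      rw [hPP] at mem
      have := mem v
      rw [hθ, hθ] at this
      have hre := congrArg Complex.re this
      have him := congrArg Complex.im this
      simp at hre him
      exact ⟨him, hre⟩
    intro v
    refine ⟨nondeg _ _ fun z => (aux z v).1, nondeg _ _ fun z => ?_⟩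
    rw [map_neg]; exact (aux z v).2
  have k1 := key F F' hF hF' h
  have k2 := key F' F hF' hF h.symm
  -- transposing `F F' = F²` gives `F' F = F²`
  have k3 : ∀ v, F' (F v) = F (F v) := by
    intro v
    refine nondeg _ _ fun z => ?_
    have e1 : g z (F' (F v)) = g (F (F' z)) v := by
      rw [hF.skew, hF'.skew, neg_neg]
    have e2 : g z (F (F v)) = g (F (F z)) v := by
      rw [hF.skew, hF.skew, neg_neg]
    rw [e1, e2, (k2 z).1]
  ext v
  have h1 : F' (F' v) = F (F v) := by rw [← (k1 v).1, k3]
  have h2 : F' (F' (F v)) = - F' v := (k1 v).2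
  have h3 : F' (F' (F v)) = F (F (F v)) := by rw [k3, k3]
  have h4 := eq_neg_of_add_eq_zero_left (hF.cube v)
  exact neg_injective (by rw [← h2, h3, h4])

/-- Existence and uniqueness of the associated f-structure in a fibre, when
`A ∘ A*` commutes with `J`. -/
theorem existsUnique_isAssociatedAt [FiniteDimensional ℝ V]
    (g : V →ₗ[ℝ] V →ₗ[ℝ] ℝ) (gsymm : ∀ v w, g v w = g w v) (gpos : ∀ v, v ≠ 0 → 0 < g v v)
    (h : W →ₗ[ℝ] W →ₗ[ℝ] ℝ)
    (J : W →ₗ[ℝ] W) (hJJ : ∀ w, J (J w) = -w) (hJ : ∀ v w, h (J v) (J w) = h v w)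
    (A : V →ₗ[ℝ] W) (As : W →ₗ[ℝ] V) (hA : ∀ w v, g (As w) v = h w (A v))
    (hdef : ∀ w, h w w = 0 → w = 0)
    (hcomm : ∀ w, A (As (J w)) = J (A (As w))) :
    ∃! F : V →ₗ[ℝ] V, IsAssociatedAt g J A F := by
  have gdef : ∀ v, g v v = 0 → v = 0 := by
    intro v hv
    by_contra hne
    exact (gpos v hne).ne' hv
  have inj : ∀ w, A (As w) = 0 → As w = 0 := by
    intro w hw
    apply gdef
    rw [hA, hw, map_zero]
  -- `V` is the direct sum of the range of `A*` and of the kernel of `A`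
  have hcompl : IsCompl (LinearMap.range As) (LinearMap.ker A) := by
    have hn := LinearMap.BilinForm.isCompl_orthogonal_of_restrict_nondegenerate
      (B := g) (W := LinearMap.range As) (fun v w hvw => by rw [gsymm]; exact hvw) (by
        constructor
        · intro v hv
          exact Subtype.ext (gdef _ (hv v))
        · intro v hv
          exact Subtype.ext (gdef _ (hv v)))
    convert hn using 1
    ext v
    simp only [LinearMap.mem_ker, LinearMap.BilinForm.mem_orthogonal_iff, LinearMap.mem_range,
      forall_exists_index, forall_apply_eq_imp_iff]
    constructor
    · intro hv w
      change g (As w) v = 0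
      rw [hA, hv, map_zero]
    · intro hv
      apply hdef
      rw [← hA]
      exact hv (A v)
  obtain ⟨s, hs⟩ := (As.rangeRestrict).exists_rightInverse_of_surjective
    (LinearMap.range_rangeRestrict As)
  let p := (LinearMap.range As).projectionOnto (LinearMap.ker A) hcompl
  let F : V →ₗ[ℝ] V := As ∘ₗ J ∘ₗ s ∘ₗ p
  have Fker : ∀ k, A k = 0 → F k = 0 := by
    intro k hk
    have : p k = 0 := by
      have hk' : k ∈ LinearMap.ker A := hk
      simpa [p] using hk'
    simp [F, this]
  have FAs : ∀ w, F (As w) = As (J w) := by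
    intro w
    have hp : p (As w) = ⟨As w, LinearMap.mem_range_self As w⟩ :=
      Submodule.projectionOnto_apply_left hcompl ⟨As w, LinearMap.mem_range_self As w⟩
    have hsw : As (s (p (As w))) = As w := by
      have := congrArg Subtype.val (LinearMap.congr_fun hs (p (As w)))
      rw [hp] at this ⊢
      exact this
    have h0 : As (J (s (p (As w)) - w)) = 0 := by
      apply inj
      rw [hcomm, map_sub As, hsw, sub_self, map_zero, map_zero]
    rw [map_sub, map_sub, sub_eq_zero] at h0
    exact h0
  have decomp : ∀ v, ∃ w k, A k = 0 ∧ v = As w + k := by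
    intro v
    have hv : v ∈ LinearMap.range As ⊔ LinearMap.ker A := by
      rw [hcompl.sup_eq_top]; trivial
    obtain ⟨a, ⟨w, rfl⟩, k, hk, rfl⟩ := Submodule.mem_sup.1 hv
    exact ⟨w, k, hk, rfl⟩
  have AF : ∀ v, A (F v) = J (A v) := by
    intro v
    obtain ⟨w, k, hk, rfl⟩ := decomp v
    rw [map_add, FAs, Fker k hk, add_zero, map_add, hk, add_zero, hcomm]
  have hFstr : IsFStructureAt g F := by
    constructor
    · intro v v'
      obtain ⟨w, k, hk, rfl⟩ := decomp v
      obtain ⟨w', k', hk', rfl⟩ := decomp v'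
      have e1 : F (As w + k) = As (J w) := by rw [map_add, FAs, Fker k hk, add_zero]
      have e2 : F (As w' + k') = As (J w') := by rw [map_add, FAs, Fker k' hk', add_zero]
      rw [e1, e2, hA, gsymm (As w + k), hA, map_add A, map_add A, hk, hk', add_zero, add_zero]
      have e3 : h (J w) (A (As w')) = - h w (A (As (J w'))) := by
        rw [← hJ, hJJ, hcomm, map_neg, LinearMap.neg_apply]
      have e4 : h w (A (As (J w'))) = h (J w') (A (As w)) := by
        rw [← hA, ← hA, gsymm]
      rw [e3, e4]
    · intro v
      obtain ⟨w, k, hk, rfl⟩ := decomp v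
      have e1 : F (As w + k) = As (J w) := by rw [map_add, FAs, Fker k hk, add_zero]
      rw [e1, FAs, FAs, hJJ, map_neg, neg_add_cancel]
  have hFass : IsAssociatedAt g J A F := by
    refine ⟨hFstr, ?_⟩
    ext θ
    constructor
    · intro hθ
      have hker : LinearMap.ker A ≤ LinearMap.ker θ := by
        intro k hk
        have := hθ k
        rw [Fker k hk, map_zero] at this
        rcases mul_eq_zero.1 this.symm with h1 | h1
        · exact absurd h1 Complex.I_ne_zero
        · exact h1
      obtain ⟨β, hβ⟩ : ∃ β : W →ₗ[ℝ] ℂ, θ = β ∘ₗ A := by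
        obtain ⟨β, hβ⟩ := LinearMap.exists_extend
          (((LinearMap.ker A).liftQ θ hker) ∘ₗ A.quotKerEquivRange.symm.toLinearMap)
        refine ⟨β, ?_⟩
        ext v
        have := LinearMap.congr_fun hβ ⟨A v, LinearMap.mem_range_self A v⟩
        have e : A.quotKerEquivRange.symm ⟨A v, LinearMap.mem_range_self A v⟩
            = (LinearMap.ker A).mkQ v := by
          rw [LinearEquiv.symm_apply_eq]
          rfl
        simp only [LinearMap.comp_apply, Submodule.subtype_apply, LinearEquiv.coe_coe, e] at this
        rw [LinearMap.comp_apply, this]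
        simp
      refine ⟨(1 / 2 : ℂ) • (β - Complex.I • (β ∘ₗ J)), ?_, ?_⟩
      · intro w
        simp only [LinearMap.smul_apply, LinearMap.sub_apply, LinearMap.comp_apply, hJJ, map_neg,
          smul_eq_mul]
        linear_combination ((1 / 2 : ℂ) * β (J w)) * Complex.I_mul_I
      · ext v
        have h1 := hθ v
        rw [hβ] at h1
        simp only [LinearMap.comp_apply, AF] at h1
        rw [hβ]
        simp only [LinearMap.smul_apply, LinearMap.sub_apply, LinearMap.comp_apply, smul_eq_mul, h1]
        linear_combination ((1 / 2 : ℂ) * β (A v)) * Complex.I_mul_I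
    · rintro ⟨α, hα, rfl⟩ v
      simp only [LinearMap.comp_apply, AF]
      exact hα (A v)
  refine ⟨F, hFass, fun F' hF' => ?_⟩
  exact hFstr.eq_of_plus gpos hF'.toIsFStructureAt (hF'.plus.trans hFass.plus.symm)

end LinearAlgebra

/-! ### Riemannian manifolds -/

section Riemannian

variable {E : Type*} [NormedAddCommGroup E] [NormedSpace ℝ E]
  {M : Type*} [TopologicalSpace M] [ChartedSpace E M]

/-- Smooth Riemannian metrics on the manifold `M` modelled on `E`. -/
abbrev Metric (E : Type*) [NormedAddCommGroup E] [NormedSpace ℝ E] (M : Type*)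
    [TopologicalSpace M] [ChartedSpace E M] [IsManifold 𝓘(ℝ, E) ∞ M] :=
  ContMDiffRiemannianMetric 𝓘(ℝ, E) ∞ E (fun x : M => TangentSpace 𝓘(ℝ, E) x)

/-- (Not necessarily continuous) fields of endomorphisms of the tangent bundle of `M`. -/
abbrev EndField (E : Type*) [NormedAddCommGroup E] [NormedSpace ℝ E] (M : Type*)
    [TopologicalSpace M] [ChartedSpace E M] :=
  (x : M) → TangentSpace 𝓘(ℝ, E) x →L[ℝ] TangentSpace 𝓘(ℝ, E) x

/-- Smooth sections of `End(TM)`. -/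
def EndField.IsSmooth [IsManifold 𝓘(ℝ, E) ∞ M] (T : EndField E M) : Prop :=
  ContMDiff 𝓘(ℝ, E) (𝓘(ℝ, E).prod 𝓘(ℝ, E →L[ℝ] E)) ∞
    (fun x => TotalSpace.mk' (E →L[ℝ] E)
      (E := fun x : M => TangentSpace 𝓘(ℝ, E) x →L[ℝ] TangentSpace 𝓘(ℝ, E) x) x (T x))

instance [FiniteDimensional ℝ E] (x : M) : FiniteDimensional ℝ (TangentSpace 𝓘(ℝ, E) x) :=
  inferInstanceAs (FiniteDimensional ℝ E)

instance (x : M) : T2Space (TangentSpace 𝓘(ℝ, E) x) :=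
  inferInstanceAs (T2Space E)

variable [IsManifold 𝓘(ℝ, E) ∞ M]

/-- The metric at `x` as a bilinear form. -/
noncomputable def Metric.bilin (g : Metric E M) (x : M) :
    TangentSpace 𝓘(ℝ, E) x →ₗ[ℝ] TangentSpace 𝓘(ℝ, E) x →ₗ[ℝ] ℝ :=
  ContinuousLinearMap.coeLM ℝ ∘ₗ (g.inner x).toLinearMap

theorem Metric.bilin_apply (g : Metric E M) (x : M) (v w : TangentSpace 𝓘(ℝ, E) x) :
    g.bilin x v w = g.inner x v w := rfl

theorem Metric.inner_injective (g : Metric E M) (x : M) :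
    Function.Injective (g.inner x).toLinearMap := by
  refine (injective_iff_map_eq_zero _).2 fun v hv => ?_
  by_contra hne
  have h1 := g.pos x v hne
  have h2 : g.inner x v = 0 := hv
  rw [h2] at h1
  simp at h1

variable [FiniteDimensional ℝ E]

/-- The musical isomorphism `v ↦ g(v, ·)` from `T_xM` to `T_x*M`. -/
noncomputable def Metric.flat (g : Metric E M) (x : M) :
    TangentSpace 𝓘(ℝ, E) x ≃ₗ[ℝ] (TangentSpace 𝓘(ℝ, E) x →L[ℝ] ℝ) :=
  LinearMap.linearEquivOfInjective (g.inner x).toLinearMap (g.inner_injective x)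
    ((LinearMap.toContinuousLinearMap.finrank_eq).symm.trans (Subspace.dual_finrank_eq)).symm

/-- The inverse musical isomorphism, from `T_x*M` to `T_xM`. -/
noncomputable def Metric.sharp (g : Metric E M) (x : M) :
    (TangentSpace 𝓘(ℝ, E) x →L[ℝ] ℝ) ≃ₗ[ℝ] TangentSpace 𝓘(ℝ, E) x :=
  (g.flat x).symm

theorem Metric.inner_sharp (g : Metric E M) (x : M) (ξ : TangentSpace 𝓘(ℝ, E) x →L[ℝ] ℝ)
    (v : TangentSpace 𝓘(ℝ, E) x) : g.inner x (g.sharp x ξ) v = ξ v :=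
  congrArg (fun ζ : TangentSpace 𝓘(ℝ, E) x →L[ℝ] ℝ => ζ v) ((g.flat x).apply_symm_apply ξ)

/-- The metric in the coordinates of the preferred chart at `x`: for `u` in the target of the
chart, `metricInChart g x u v w = g_{ij}(u) vⁱ wʲ`. -/
noncomputable def metricInChart (g : Metric E M) (x : M) (u : E) : E →L[ℝ] E →L[ℝ] ℝ :=
  let c := extChartAt 𝓘(ℝ, E) x
  let D : E →L[ℝ] TangentSpace 𝓘(ℝ, E) (c.symm u) := mfderiv 𝓘(ℝ, E) 𝓘(ℝ, E) c.symm u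
  let G : E →L[ℝ] E →L[ℝ] ℝ := g.inner (c.symm u)
  G.bilinearComp D D

/-- A field of endomorphisms in the coordinates of the preferred chart at `x`. -/
noncomputable def endInChart (T : EndField E M) (x : M) (u : E) : E →L[ℝ] E :=
  let c := extChartAt 𝓘(ℝ, E) x
  let D : E →L[ℝ] TangentSpace 𝓘(ℝ, E) (c.symm u) := mfderiv 𝓘(ℝ, E) 𝓘(ℝ, E) c.symm u
  let D' : TangentSpace 𝓘(ℝ, E) (c.symm u) →L[ℝ] E := mfderiv 𝓘(ℝ, E) 𝓘(ℝ, E) c (c.symm u)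
  D' ∘L T (c.symm u) ∘L D

set_option synthInstance.maxHeartbeats 200000 in
/-- The Christoffel symbols of the Levi-Civita connection at `x`, in the preferred chart at `x`:
`christoffel g x v w = Γᵏ_{ij}(x) vⁱ wʲ ∂_k`, where
`Γᵏ_{ij} = ½ gᵏˡ (∂_i g_{jl} + ∂_j g_{il} - ∂_l g_{ij})`.
In Mathlib the tangent space at `x` is the model space `E`, identified with the tangent space
through the preferred chart at `x`, so that coordinate vectors of this chart at the
point `x` are elements of `TangentSpace 𝓘(ℝ, E) x`, and `g_x` is the metric at `x` in this chart. -/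
noncomputable def christoffel (g : Metric E M) (x : M) (v w : TangentSpace 𝓘(ℝ, E) x) :
    TangentSpace 𝓘(ℝ, E) x :=
  let dg : E →L[ℝ] E →L[ℝ] E →L[ℝ] ℝ := fderiv ℝ (metricInChart g x) (extChartAt 𝓘(ℝ, E) x x)
  let v' : E := v
  let w' : E := w
  let ξ : E →L[ℝ] ℝ := (1 / 2 : ℝ) • (dg v' w' + dg w' v' - (dg.flip v').flip w')
  g.sharp x ξ

/-- The covariant derivative `(∇_v T) w` at `x` of a field of endomorphisms, for the
Levi-Civita connection `∇` of `g`: in coordinates,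
`(∇_i T)ᵏ_j = ∂_i Tᵏ_j + Γᵏ_{il} Tˡ_j - Γˡ_{ij} Tᵏ_l`. -/
noncomputable def covDerivEnd (g : Metric E M) (T : EndField E M) (x : M)
    (v w : TangentSpace 𝓘(ℝ, E) x) : TangentSpace 𝓘(ℝ, E) x :=
  let dT : E →L[ℝ] E →L[ℝ] E := fderiv ℝ (endInChart T x) (extChartAt 𝓘(ℝ, E) x x)
  let dTvw : TangentSpace 𝓘(ℝ, E) x := dT v w
  dTvw + christoffel g x v (T x w) - T x (christoffel g x v w)

/-- The (smooth) field of endomorphisms `T` is parallel: `∇T = 0`. -/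
def IsParallel (g : Metric E M) (T : EndField E M) : Prop :=
  ∀ (x : M) (v w : TangentSpace 𝓘(ℝ, E) x), covDerivEnd g T x v w = 0

/-- An f-structure on `(M, g)`: a smooth skew-symmetric section `F` of `End(TM)` such that
`F³ + F = 0`. -/
structure IsFStructure (g : Metric E M) (F : EndField E M) : Prop where
  smooth : F.IsSmooth
  isFStructureAt : ∀ x, IsFStructureAt (g.bilin x) (F x).toLinearMap

/-- An almost complex structure `J` on `M`, for which the Riemannian metric `h` is Hermitian. -/
structure AlmostHermitianStructure (h : Metric E M) where
  /-- The underlying field of endomorphisms. -/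
  J : EndField E M
  smooth : J.IsSmooth
  sq : ∀ x v, J x (J x v) = -v
  inner_map_map : ∀ x v w, h.inner x (J x v) (J x w) = h.inner x v w

/-- The almost Hermitian manifold `(M, h, J)` is Kähler: `J` is parallel for the Levi-Civita
connection of `h`. (Since the connection is torsion-free, `J` is then integrable.) -/
def AlmostHermitianStructure.IsKaehler {h : Metric E M} (J : AlmostHermitianStructure h) : Prop :=
  IsParallel h J.J

end Riemannian

/-! ### Maps from a Riemannian manifold to an almost Hermitian manifold -/

section Maps

variable {E : Type*} [NormedAddCommGroup E] [NormedSpace ℝ E] [FiniteDimensional ℝ E]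
  {M : Type*} [TopologicalSpace M] [ChartedSpace E M] [IsManifold 𝓘(ℝ, E) ∞ M]
  {E' : Type*} [NormedAddCommGroup E'] [NormedSpace ℝ E'] [FiniteDimensional ℝ E']
  {N : Type*} [TopologicalSpace N] [ChartedSpace E' N] [IsManifold 𝓘(ℝ, E') ∞ N]

/-- The differential `dφ_x : T_xM → T_{φ(x)}N`. -/
noncomputable abbrev dmap (φ : M → N) (x : M) :
    TangentSpace 𝓘(ℝ, E) x →L[ℝ] TangentSpace 𝓘(ℝ, E') (φ x) :=
  mfderiv 𝓘(ℝ, E) 𝓘(ℝ, E') φ x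

/-- The map `(dφ_x)* : T_{φ(x)}N → T_xM`: the transpose of `dφ_x`, after identifying tangent and
cotangent spaces by means of the metrics `g` and `h`. -/
noncomputable def codmap (g : Metric E M) (h : Metric E' N) (φ : M → N) (x : M) :
    TangentSpace 𝓘(ℝ, E') (φ x) →ₗ[ℝ] TangentSpace 𝓘(ℝ, E) x where
  toFun w := g.sharp x ((h.inner (φ x) w) ∘L dmap φ x)
  map_add' w w' := by
    rw [map_add, ContinuousLinearMap.add_comp, map_add]
  map_smul' r w := by
    rw [map_smul, ContinuousLinearMap.smul_comp, map_smul, RingHom.id_apply]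

theorem inner_codmap (g : Metric E M) (h : Metric E' N) (φ : M → N) (x : M)
    (w : TangentSpace 𝓘(ℝ, E') (φ x)) (v : TangentSpace 𝓘(ℝ, E) x) :
    g.inner x (codmap g h φ x w) v = h.inner (φ x) w (dmap φ x v) :=
  g.inner_sharp x _ v

/-- `φ` is pseudo horizontally weakly conformal: `[dφ ∘ (dφ)*, J] = 0`. -/
def IsPHWC (g : Metric E M) {h : Metric E' N} (J : AlmostHermitianStructure h) (φ : M → N) : Prop :=
  ∀ (x : M) (w : TangentSpace 𝓘(ℝ, E') (φ x)),
    dmap φ x (codmap g h φ x (J.J (φ x) w)) = J.J (φ x) (dmap φ x (codmap g h φ x w))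

/-- If `φ` is pseudo horizontally weakly conformal, there is at each point `x` of `M` exactly one
f-structure on `T_xM` with `T*⁺_xM = (dφ_x)*(T*^{(1,0)}_{φ(x)}N)`. -/
theorem IsPHWC.existsUnique {g : Metric E M} {h : Metric E' N} {J : AlmostHermitianStructure h}
    {φ : M → N} (hφ : IsPHWC g J φ) (x : M) :
    ∃! F : TangentSpace 𝓘(ℝ, E) x →ₗ[ℝ] TangentSpace 𝓘(ℝ, E) x,
      IsAssociatedAt (g.bilin x) (J.J (φ x)).toLinearMap (dmap φ x).toLinearMap F := by
  refine existsUnique_isAssociatedAt (g.bilin x) (g.symm x) (g.pos x)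
    (h.bilin (φ x)) _ (J.sq (φ x)) (J.inner_map_map (φ x)) _
    (codmap g h φ x) (inner_codmap g h φ x) ?_ (hφ x)
  intro w hw
  by_contra hne
  exact (h.pos (φ x) w hne).ne' hw

/-- The f-structure `F^φ` associated to a pseudo horizontally weakly conformal map `φ`: the skew
endomorphism of `T_xM` with `F³ + F = 0` whose space of covectors of type `+` is
`(dφ_x)*(T*^{(1,0)}_{φ(x)}N)`. -/
noncomputable def associatedFStructure {g : Metric E M} {h : Metric E' N}
    {J : AlmostHermitianStructure h} {φ : M → N} (hφ : IsPHWC g J φ) : EndField E M :=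
  fun x => LinearMap.toContinuousLinearMap (hφ.existsUnique x).choose

theorem isAssociatedAt_associatedFStructure {g : Metric E M} {h : Metric E' N}
    {J : AlmostHermitianStructure h} {φ : M → N} (hφ : IsPHWC g J φ) (x : M) :
    IsAssociatedAt (g.bilin x) (J.J (φ x)).toLinearMap (dmap φ x).toLinearMap
      (associatedFStructure hφ x).toLinearMap :=
  (hφ.existsUnique x).choose_spec.1

/-- The second fundamental form `∇dφ` at `x`, for the connection on `T*M ⊗ φ⁻¹TN` induced by the
Levi-Civita connections: in coordinates,
`(∇dφ)^α_{ij} = ∂_i ∂_j φ^α - Γᵏ_{ij} ∂_k φ^α + Γ^α_{βγ} ∂_i φ^β ∂_j φ^γ`. -/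
noncomputable def secondFundamentalForm (g : Metric E M) (h : Metric E' N) (φ : M → N) (x : M)
    (v w : TangentSpace 𝓘(ℝ, E) x) : TangentSpace 𝓘(ℝ, E') (φ x) :=
  let d2φ : E →L[ℝ] E →L[ℝ] E' :=
    fderiv ℝ (fderiv ℝ (writtenInExtChartAt 𝓘(ℝ, E) 𝓘(ℝ, E') x φ)) (extChartAt 𝓘(ℝ, E) x x)
  let d2φvw : TangentSpace 𝓘(ℝ, E') (φ x) := d2φ v w
  d2φvw - dmap φ x (christoffel g x v w) + christoffel h (φ x) (dmap φ x v) (dmap φ x w)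

/-- The tension field `τ(φ) = gⁱʲ (∇dφ)_{ij}`, the trace of `∇dφ` with respect to `g`. Here
`(dxⁱ)♯ = gⁱʲ ∂_j`. -/
noncomputable def tension (g : Metric E M) (h : Metric E' N) (φ : M → N) (x : M) :
    TangentSpace 𝓘(ℝ, E') (φ x) :=
  let b := Module.finBasis ℝ (TangentSpace 𝓘(ℝ, E) x)
  ∑ i, secondFundamentalForm g h φ x (b i)
    (g.sharp x (LinearMap.toContinuousLinearMap (b.coord i)))

/-- `φ` is harmonic: its tension field vanishes. -/
def IsHarmonic (g : Metric E M) (h : Metric E' N) (φ : M → N) : Prop :=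
  ∀ x, tension g h φ x = 0

end Maps

end PHWC

/-! Write `F` for the associated f-structure. Pulling back a (1,0)-covector by `dφ` gives a covector
of type `+`, and (1,0)-covectors separate points, so `dφ ∘ F = J ∘ dφ` (`IsAssociatedAt.comp_eq`).
Differentiating this covariantly, with `∇F = 0` and `∇J = 0`, gives `∇dφ(v, F w) = J ∇dφ(v, w)`
(`secondFundamentalForm_intertwining`).

Since `∇dφ` is symmetric, `F` can be moved out of either slot as `J`. In the metric trace, however,
skewness of `F` moves it from one slot to the other with a minus sign. Hence `J τ = -J τ`, so `J τ =
0` and `τ = 0` because `J` is invertible (`sum_eq_zero_of_intertwining`).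

The analytic work is to read the intertwining relation in charts near a point, differentiate it with
the ordinary product and chain rules, and absorb the Christoffel terms through the two parallelism
equations. -/

namespace PHWC

/-! ### Linear algebra: intertwining and vanishing metric traces -/

section LinearAlgebra

variable {V W : Type*} [AddCommGroup V] [Module ℝ V] [AddCommGroup W] [Module ℝ W]

/-- Covectors of type `(1,0)` separate the points of `(W, J)`. -/
theorem eq_of_forall_plusCovectors {J : W →ₗ[ℝ] W} (hJJ : ∀ w, J (J w) = -w) {w w' : W}
    (h : ∀ α ∈ plusCovectors J, α w = α w') : w = w' := by
  rw [← sub_eq_zero, ← Module.forall_dual_apply_eq_zero_iff ℝ]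
  intro β
  -- `β - i β ∘ J` is the (1,0)-covector with real part `β`; taking real parts therefore recovers an
  -- arbitrary real covector.
  let α : W →ₗ[ℝ] ℂ := Complex.ofRealCLM.toLinearMap ∘ₗ β -
    Complex.I • (Complex.ofRealCLM.toLinearMap ∘ₗ β ∘ₗ J)
  have hα : ∀ u, α u = (β u : ℂ) - Complex.I * (β (J u) : ℂ) := fun u => by simp [α]
  have mem : α ∈ plusCovectors J := by
    intro u
    rw [hα, hα, hJJ, map_neg]
    push_cast
    linear_combination ((β (J u)) : ℂ) * Complex.I_mul_I
  have := congrArg Complex.re (h α mem)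
  rw [hα, hα] at this
  simp only [Complex.sub_re, Complex.mul_re, Complex.ofReal_re, Complex.I_re, Complex.ofReal_im,
    Complex.I_im] at this
  rw [map_sub]
  linarith

/-- The linear map `A` intertwines its associated f-structure with `J`. -/
theorem IsAssociatedAt.comp_eq {g : V →ₗ[ℝ] V →ₗ[ℝ] ℝ} {J : W →ₗ[ℝ] W} {A : V →ₗ[ℝ] W}
    {F : V →ₗ[ℝ] V} (hF : IsAssociatedAt g J A F) (hJJ : ∀ w, J (J w) = -w) (v : V) :
    A (F v) = J (A v) := by
  refine eq_of_forall_plusCovectors hJJ fun α hα => ?_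
  have : α ∘ₗ A ∈ plusCovectors F := by
    rw [hF.plus]
    exact ⟨α, hα, rfl⟩
  exact (this v).trans (hα (A v)).symm

/-- Transposition of a skew-symmetric endomorphism inside a metric trace; `s` is the inverse of
the musical isomorphism. -/
theorem sum_apply_skew {ι : Type*} [Fintype ι] (b : Module.Basis ι ℝ V) {g : V →ₗ[ℝ] V →ₗ[ℝ] ℝ}
    (s : (V →ₗ[ℝ] ℝ) →ₗ[ℝ] V) (hs : ∀ ξ v, g (s ξ) v = ξ v) (hg : Function.Injective g)
    {F : V →ₗ[ℝ] V} (hF : ∀ v w, g (F v) w = -g v (F w)) (B : V →ₗ[ℝ] V →ₗ[ℝ] W) :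
    ∑ i, B (F (b i)) (s (b.coord i)) = -∑ i, B (b i) (F (s (b.coord i))) := by
  -- The left side is `s (b^j ∘ F)`. Pairing with `v` gives `b^j (F v) = g (s b^j) (F v) = -g (F (s
  -- b^j)) v`.
  have key : ∀ j, ∑ i, b.coord j (F (b i)) • s (b.coord i) = -F (s (b.coord j)) := by
    intro j
    apply hg
    ext v
    rw [map_neg, LinearMap.neg_apply, hF, neg_neg, hs]
    conv_rhs => rw [← b.sum_repr v]
    simp only [map_sum, map_smul, LinearMap.sum_apply, LinearMap.smul_apply, smul_eq_mul, hs,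
      Module.Basis.coord_apply]
    exact Finset.sum_congr rfl fun i _ => mul_comm _ _
  calc ∑ i, B (F (b i)) (s (b.coord i))
      = ∑ i, ∑ j, b.coord j (F (b i)) • B (b j) (s (b.coord i)) := by
        refine Finset.sum_congr rfl fun i _ => ?_
        conv_lhs => rw [← b.sum_repr (F (b i))]
        simp only [map_sum, map_smul, LinearMap.sum_apply, LinearMap.smul_apply,
          Module.Basis.coord_apply]
    _ = ∑ j, B (b j) (∑ i, b.coord j (F (b i)) • s (b.coord i)) := by
        rw [Finset.sum_comm]
        simp only [map_sum, map_smul]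
    _ = -∑ i, B (b i) (F (s (b.coord i))) := by
        simp only [key, map_neg, Finset.sum_neg_distrib]

/-- The metric trace of a symmetric bilinear map which intertwines a skew-symmetric endomorphism
with a complex structure vanishes. -/
theorem sum_eq_zero_of_intertwining {ι : Type*} [Fintype ι] (b : Module.Basis ι ℝ V)
    {g : V →ₗ[ℝ] V →ₗ[ℝ] ℝ}
    (s : (V →ₗ[ℝ] ℝ) →ₗ[ℝ] V) (hs : ∀ ξ v, g (s ξ) v = ξ v) (hg : Function.Injective g)
    {F : V →ₗ[ℝ] V} (hF : ∀ v w, g (F v) w = -g v (F w)) {J : W →ₗ[ℝ] W}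
    (hJJ : ∀ w, J (J w) = -w) (B : V →ₗ[ℝ] V →ₗ[ℝ] W) (hB : ∀ v w, B v w = B w v)
    (hBF : ∀ v w, B v (F w) = J (B v w)) :
    ∑ i, B (b i) (s (b.coord i)) = 0 := by
  have h1 := sum_apply_skew b s hs hg hF B
  have h2 : ∑ i, B (F (b i)) (s (b.coord i)) = J (∑ i, B (b i) (s (b.coord i))) := by
    rw [map_sum]
    exact Finset.sum_congr rfl fun i _ => by rw [hB, hBF, hB]
  have h3 : ∑ i, B (b i) (F (s (b.coord i))) = J (∑ i, B (b i) (s (b.coord i))) := by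
    rw [map_sum]
    exact Finset.sum_congr rfl fun i _ => hBF _ _
  -- With `t` the trace, `h1` now reads `J t = -J t`; so `J t = 0`, and then `-t = J (J t) = 0`.
  rw [h2, h3, eq_neg_iff_add_eq_zero, ← two_smul ℝ, smul_eq_zero_iff_right two_ne_zero] at h1
  rw [← neg_eq_zero, ← hJJ, h1, map_zero]

end LinearAlgebra

/-! ### Endomorphism fields in charts -/

section Charts

variable {E : Type*} [NormedAddCommGroup E] [NormedSpace ℝ E]
  {M : Type*} [TopologicalSpace M] [ChartedSpace E M] [IsManifold 𝓘(ℝ, E) ∞ M]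

theorem mfderiv_extChartAt_symm_apply_mfderiv_extChartAt {x p : M}
    (hp : p ∈ (extChartAt 𝓘(ℝ, E) x).source) (v : TangentSpace 𝓘(ℝ, E) p) :
    (mfderiv 𝓘(ℝ, E) 𝓘(ℝ, E) (extChartAt 𝓘(ℝ, E) x).symm (extChartAt 𝓘(ℝ, E) x p) : E →L[ℝ] E)
      (mfderiv 𝓘(ℝ, E) 𝓘(ℝ, E) (extChartAt 𝓘(ℝ, E) x) p v) = v := by
  have := mfderivWithin_extChartAt_symm_comp_mfderiv_extChartAt' (I := 𝓘(ℝ, E)) hp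
  rw [modelWithCornersSelf_coe, range_id, mfderivWithin_univ] at this
  exact ContinuousLinearMap.ext_iff.1 this v

theorem mfderiv_extChartAt_symm_self (x : M) :
    mfderiv 𝓘(ℝ, E) 𝓘(ℝ, E) (extChartAt 𝓘(ℝ, E) x).symm (extChartAt 𝓘(ℝ, E) x x)
      = ContinuousLinearMap.id ℝ E := by
  have := mfderivWithin_range_extChartAt_symm (I := 𝓘(ℝ, E)) (x := x)
  rwa [modelWithCornersSelf_coe, range_id, mfderivWithin_univ] at this

omit [IsManifold 𝓘(ℝ, E) ∞ M] in
theorem endInChart_apply (T : EndField E M) {x p : M} (hp : p ∈ (extChartAt 𝓘(ℝ, E) x).source)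
    (v : E) :
    endInChart T x (extChartAt 𝓘(ℝ, E) x p) v =
      mfderiv 𝓘(ℝ, E) 𝓘(ℝ, E) (extChartAt 𝓘(ℝ, E) x) p (T p
        ((mfderiv 𝓘(ℝ, E) 𝓘(ℝ, E) (extChartAt 𝓘(ℝ, E) x).symm (extChartAt 𝓘(ℝ, E) x p) :
          E →L[ℝ] E) v)) := by
  -- The point `c.symm (c p)` equals `p` only propositionally, and the tangent spaces depend on it.
  -- With the base point a free variable `q` and `D` typed over the model space, the equality can be
  -- substituted.
  have aux : ∀ (q : M) (D : E →L[ℝ] E), q = p →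
      ((mfderiv 𝓘(ℝ, E) 𝓘(ℝ, E) (extChartAt 𝓘(ℝ, E) x) q : E →L[ℝ] E)
        ((T q : E →L[ℝ] E) (D v)) : E) =
      (mfderiv 𝓘(ℝ, E) 𝓘(ℝ, E) (extChartAt 𝓘(ℝ, E) x) p : E →L[ℝ] E)
        ((T p : E →L[ℝ] E) (D v)) := by
    rintro q D rfl
    rfl
  exact aux _ _ ((extChartAt 𝓘(ℝ, E) x).left_inv hp)

theorem endInChart_self (T : EndField E M) (x : M) :
    endInChart T x (extChartAt 𝓘(ℝ, E) x x) = (T x : E →L[ℝ] E) := by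
  ext v
  rw [endInChart_apply T (mem_extChartAt_source x), mfderiv_extChartAt_self,
    mfderiv_extChartAt_symm_self]
  rfl

/-- Smoothness of the section means smoothness of `inCoordinates` in the trivializations at `x`.
These are given by the differentials of the chart and of its inverse, so on the chart target this
expression is `endInChart`. -/
theorem EndField.IsSmooth.differentiableAt_endInChart {T : EndField E M} (hT : T.IsSmooth)
    (x : M) : DifferentiableAt ℝ (endInChart T x) (extChartAt 𝓘(ℝ, E) x x) := by
  have h1 := ((contMDiffAt_hom_bundle _).1 (hT x)).2
  have h2 : ContMDiffAt 𝓘(ℝ, E) 𝓘(ℝ, E) ∞ (extChartAt 𝓘(ℝ, E) x).symm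
      (extChartAt 𝓘(ℝ, E) x x) :=
    (contMDiffOn_extChartAt_symm x).contMDiffAt (extChartAt_target_mem_nhds x)
  rw [← (extChartAt 𝓘(ℝ, E) x).left_inv (mem_extChartAt_source x)] at h1
  have h3 := (h1.comp _ h2).contDiffAt.differentiableAt (by simp)
  refine h3.congr_of_eventuallyEq ?_
  filter_upwards [extChartAt_target_mem_nhds (I := 𝓘(ℝ, E)) x] with u hu
  have hp := (extChartAt 𝓘(ℝ, E) x).map_target hu
  rw [extChartAt_source] at hp
  have e := (extChartAt 𝓘(ℝ, E) x).left_inv (mem_extChartAt_source (I := 𝓘(ℝ, E)) x)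
  simp only [Function.comp_apply, e]
  rw [ContinuousLinearMap.inCoordinates, TangentBundle.continuousLinearMapAt_trivializationAt hp,
    TangentBundle.symmL_trivializationAt hp, modelWithCornersSelf_coe, range_id,
    mfderivWithin_univ, (extChartAt 𝓘(ℝ, E) x).right_inv hu]
  rfl

end Charts

/-! ### Symmetry and linearity of the Christoffel symbols -/

section ChristoffelForm

variable {E : Type*} [NormedAddCommGroup E] [NormedSpace ℝ E]

/-- The Christoffel symbols of the first kind, in terms of the derivative of the metric. -/
noncomputable def christoffelForm (dg : E →L[ℝ] E →L[ℝ] E →L[ℝ] ℝ) (v w : E) : E →L[ℝ] ℝ :=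
  (1 / 2 : ℝ) • (dg v w + dg w v - (dg.flip v).flip w)

theorem christoffelForm_apply (dg : E →L[ℝ] E →L[ℝ] E →L[ℝ] ℝ) (v w z : E) :
    christoffelForm dg v w z = (1 / 2 : ℝ) * (dg v w z + dg w v z - dg z v w) := rfl

theorem christoffelForm_symm {dg : E →L[ℝ] E →L[ℝ] E →L[ℝ] ℝ}
    (h : ∀ z v w, dg z v w = dg z w v) (v w : E) :
    christoffelForm dg v w = christoffelForm dg w v := by
  ext z
  rw [christoffelForm_apply, christoffelForm_apply, h z v w, add_comm]

set_option synthInstance.maxHeartbeats 200000 in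
theorem christoffelForm_add (dg : E →L[ℝ] E →L[ℝ] E →L[ℝ] ℝ) (v w w' : E) :
    christoffelForm dg v (w + w') = christoffelForm dg v w + christoffelForm dg v w' := by
  ext z
  simp only [christoffelForm_apply, map_add, add_apply]
  ring

set_option synthInstance.maxHeartbeats 200000 in
theorem christoffelForm_smul (dg : E →L[ℝ] E →L[ℝ] E →L[ℝ] ℝ) (r : ℝ) (v w : E) :
    christoffelForm dg v (r • w) = r • christoffelForm dg v w := by
  ext z
  simp only [christoffelForm_apply, map_smul, smul_apply, smul_eq_mul]
  ring

end ChristoffelForm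

section Christoffel

variable {E : Type*} [NormedAddCommGroup E] [NormedSpace ℝ E]
  {M : Type*} [TopologicalSpace M] [ChartedSpace E M] [IsManifold 𝓘(ℝ, E) ∞ M]

theorem fderiv_metricInChart_symm (g : Metric E M) (x : M) (u z v w : E) :
    fderiv ℝ (metricInChart g x) u z v w = fderiv ℝ (metricInChart g x) u z w v := by
  have hsymm : ∀ u' v w, metricInChart g x u' v w = metricInChart g x u' w v :=
    fun u' v w => g.symm _ _ _
  -- If the metric were not differentiable, its `fderiv` would be zero and so symmetric; no
  -- smoothness in the chart has to be proved.
  by_cases hd : DifferentiableAt ℝ (metricInChart g x) u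
  · have h : ∀ v w : E, HasFDerivAt (fun u' => metricInChart g x u' v w)
        (((fderiv ℝ (metricInChart g x) u).flip v).flip w) u := by
      intro v w
      have h1 := hd.hasFDerivAt.clm_apply (hasFDerivAt_const v u)
      have h2 := h1.clm_apply (hasFDerivAt_const w u)
      refine h2.congr_fderiv ?_
      ext z
      simp
    have h2 := h w v
    simp only [hsymm _ w v] at h2
    exact ContinuousLinearMap.ext_iff.1 ((h v w).unique h2) z
  · simp [fderiv_zero_of_not_differentiableAt hd]

variable [FiniteDimensional ℝ E]

/-- Torsion-freeness of the connection. `christoffel` is definitionally the sharp of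
`christoffelForm`, whose first two terms are exchanged and whose third is symmetric because the
metric is. -/
theorem christoffel_symm (g : Metric E M) (x : M) (v w : TangentSpace 𝓘(ℝ, E) x) :
    christoffel g x v w = christoffel g x w v :=
  congrArg (g.sharp x) (christoffelForm_symm (E := E) (fderiv_metricInChart_symm g x _) v w)

theorem christoffel_add (g : Metric E M) (x : M) (v w w' : TangentSpace 𝓘(ℝ, E) x) :
    christoffel g x v (w + w') = christoffel g x v w + christoffel g x v w' :=
  (congrArg (g.sharp x) (christoffelForm_add (E := E) _ v w w')).trans (map_add (g.sharp x) _ _)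

theorem christoffel_smul (g : Metric E M) (x : M) (r : ℝ) (v w : TangentSpace 𝓘(ℝ, E) x) :
    christoffel g x v (r • w) = r • christoffel g x v w :=
  (congrArg (g.sharp x) (christoffelForm_smul (E := E) _ r v w)).trans
    (map_smul (g.sharp x) r _)

end Christoffel

end PHWC

namespace PHWC

/-! ### Differentiating the intertwining relation -/

section NormedSpace

variable {E E' : Type*} [NormedAddCommGroup E] [NormedSpace ℝ E] [NormedAddCommGroup E']
  [NormedSpace ℝ E']

/-- The derivative of the relation `df ∘ T = S ∘ df`. -/
theorem fderiv_fderiv_apply_of_intertwining {f : E → E'} {T : E → E →L[ℝ] E}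
    {S : E' → E' →L[ℝ] E'} {u : E} (hf : ContDiffAt ℝ 2 f u) (hT : DifferentiableAt ℝ T u)
    (hS : DifferentiableAt ℝ S (f u))
    (h : ∀ᶠ y in 𝓝 u, ∀ w, fderiv ℝ f y (T y w) = S (f y) (fderiv ℝ f y w)) (v w : E) :
    fderiv ℝ (fderiv ℝ f) u v (T u w) + fderiv ℝ f u (fderiv ℝ T u v w) =
      fderiv ℝ S (f u) (fderiv ℝ f u v) (fderiv ℝ f u w) +
        S (f u) (fderiv ℝ (fderiv ℝ f) u v w) := by
  have hdf : HasFDerivAt f (fderiv ℝ f u) u := (hf.differentiableAt (by simp)).hasFDerivAt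
  have hd2f : HasFDerivAt (fderiv ℝ f) (fderiv ℝ (fderiv ℝ f) u) u :=
    ((hf.fderiv_right (m := 1) (by norm_num)).differentiableAt (by simp)).hasFDerivAt
  have h1 := hd2f.clm_apply (hT.hasFDerivAt.clm_apply (hasFDerivAt_const w u))
  have h2 := (hS.hasFDerivAt.comp u hdf).clm_apply (hd2f.clm_apply (hasFDerivAt_const w u))
  -- For fixed `w` both sides are functions of the base point that agree near `u`, so their
  -- derivatives there coincide.
  have h3 := h1.unique (h2.congr_of_eventuallyEq (h.mono fun y hy => hy w))
  have h4 := ContinuousLinearMap.ext_iff.1 h3 v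
  simpa [add_comm] using h4

end NormedSpace

section LinearAlgebra

variable {V W : Type*} [AddCommGroup V] [Module ℝ V] [AddCommGroup W] [Module ℝ W]

/-- The pointwise algebra that turns ordinary derivatives into covariant ones. `A` is `dφ`; `X`,
`X'` are the second derivatives of `φ` on `(v, T w)` and `(v, w)`; `d`, `s` are the derivatives of
`T` and `S`; `a`, `a'` and `b`, `b'` are the Christoffel terms of source and target, and `Ta` is `T
a`. Parallelism eliminates `d` and `s`. -/
theorem map_sub_add_eq_of_parallel (A : V →ₗ[ℝ] W) (S : W →ₗ[ℝ] W) {X X' s b b' : W} {d a a' Ta : V}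
    (h : X + A d = s + S X') (hT : d + a' - Ta = 0) (hS : s + b' - S b = 0)
    (hTa : A Ta = S (A a)) : X - A a' + b' = S (X' - A a + b) := by
  have h1 : d = Ta - a' := by rw [← sub_eq_zero, ← hT]; abel
  have h2 : s = S b - b' := by rw [← sub_eq_zero, ← hS]; abel
  rw [h1, h2, map_sub, hTa] at h
  rw [map_add, map_sub, ← sub_eq_zero]
  rw [← sub_eq_zero] at h
  rw [← h]
  abel

end LinearAlgebra

/-! ### The intertwining relation in charts and for `∇dφ` -/

section Maps

variable {E : Type*} [NormedAddCommGroup E] [NormedSpace ℝ E]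
  {M : Type*} [TopologicalSpace M] [ChartedSpace E M] [IsManifold 𝓘(ℝ, E) ∞ M]
  {E' : Type*} [NormedAddCommGroup E'] [NormedSpace ℝ E']
  {N : Type*} [TopologicalSpace N] [ChartedSpace E' N] [IsManifold 𝓘(ℝ, E') ∞ N]

omit [IsManifold 𝓘(ℝ, E) ∞ M] [IsManifold 𝓘(ℝ, E') ∞ N] in
theorem contDiffAt_writtenInExtChartAt {φ : M → N} {x : M}
    (hφ : ContMDiffAt 𝓘(ℝ, E) 𝓘(ℝ, E') ∞ φ x) :
    ContDiffAt ℝ ∞ (writtenInExtChartAt 𝓘(ℝ, E) 𝓘(ℝ, E') x φ) (extChartAt 𝓘(ℝ, E) x x) := by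
  have := (contMDiffAt_iff.1 hφ).2
  rwa [modelWithCornersSelf_coe, range_id, contDiffWithinAt_univ] at this

omit [IsManifold 𝓘(ℝ, E) ∞ M] [IsManifold 𝓘(ℝ, E') ∞ N] in
theorem fderiv_writtenInExtChartAt_self {φ : M → N} {x : M}
    (hφ : MDifferentiableAt 𝓘(ℝ, E) 𝓘(ℝ, E') φ x) :
    fderiv ℝ (writtenInExtChartAt 𝓘(ℝ, E) 𝓘(ℝ, E') x φ) (extChartAt 𝓘(ℝ, E) x x) =
      (mfderiv 𝓘(ℝ, E) 𝓘(ℝ, E') φ x : E →L[ℝ] E') := by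
  have h := hφ.mfderiv
  rw [modelWithCornersSelf_coe, range_id, fderivWithin_univ] at h
  exact h.symm

theorem fderiv_writtenInExtChartAt {φ : M → N} {x p : M}
    (hφ : MDifferentiableAt 𝓘(ℝ, E) 𝓘(ℝ, E') φ p) (hp : p ∈ (extChartAt 𝓘(ℝ, E) x).source)
    (hφp : φ p ∈ (extChartAt 𝓘(ℝ, E') (φ x)).source) (v : E) :
    fderiv ℝ (writtenInExtChartAt 𝓘(ℝ, E) 𝓘(ℝ, E') x φ) (extChartAt 𝓘(ℝ, E) x p) v =
      mfderiv 𝓘(ℝ, E') 𝓘(ℝ, E') (extChartAt 𝓘(ℝ, E') (φ x)) (φ p)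
        (mfderiv 𝓘(ℝ, E) 𝓘(ℝ, E') φ p
          ((mfderiv 𝓘(ℝ, E) 𝓘(ℝ, E) (extChartAt 𝓘(ℝ, E) x).symm (extChartAt 𝓘(ℝ, E) x p) :
            E →L[ℝ] E) v)) := by
  have hinv := (extChartAt 𝓘(ℝ, E) x).left_inv hp
  have h1 : HasMFDerivAt 𝓘(ℝ, E) 𝓘(ℝ, E) (extChartAt 𝓘(ℝ, E) x).symm (extChartAt 𝓘(ℝ, E) x p)
      (mfderiv 𝓘(ℝ, E) 𝓘(ℝ, E) (extChartAt 𝓘(ℝ, E) x).symm (extChartAt 𝓘(ℝ, E) x p)) := by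
    have := mdifferentiableWithinAt_extChartAt_symm (I := 𝓘(ℝ, E))
      ((extChartAt 𝓘(ℝ, E) x).map_source hp)
    rw [modelWithCornersSelf_coe, range_id, mdifferentiableWithinAt_univ] at this
    exact this.hasMFDerivAt
  have h2 : HasMFDerivAt 𝓘(ℝ, E') 𝓘(ℝ, E') (extChartAt 𝓘(ℝ, E') (φ x)) (φ p)
      (mfderiv 𝓘(ℝ, E') 𝓘(ℝ, E') (extChartAt 𝓘(ℝ, E') (φ x)) (φ p)) :=
    (mdifferentiableAt_extChartAt (by rwa [extChartAt_source] at hφp)).hasMFDerivAt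
  have h3 := h2.comp p hφ.hasMFDerivAt
  -- The chain rule with the inverse chart needs a derivative at `c.symm (c p)`, not at `p`. `L` is
  -- the derivative `h3` transported there, remembered only through its values.
  obtain ⟨L, h4, hL⟩ : ∃ L : TangentSpace 𝓘(ℝ, E) ((extChartAt 𝓘(ℝ, E) x).symm
      (extChartAt 𝓘(ℝ, E) x p)) →L[ℝ] TangentSpace 𝓘(ℝ, E') ((extChartAt 𝓘(ℝ, E') (φ x) ∘ φ)
        ((extChartAt 𝓘(ℝ, E) x).symm (extChartAt 𝓘(ℝ, E) x p))),
      HasMFDerivAt 𝓘(ℝ, E) 𝓘(ℝ, E') (extChartAt 𝓘(ℝ, E') (φ x) ∘ φ)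
        ((extChartAt 𝓘(ℝ, E) x).symm (extChartAt 𝓘(ℝ, E) x p)) L ∧
      ∀ v : E, L v = (mfderiv 𝓘(ℝ, E') 𝓘(ℝ, E') (extChartAt 𝓘(ℝ, E') (φ x)) (φ p) : E' →L[ℝ] E')
        ((mfderiv 𝓘(ℝ, E) 𝓘(ℝ, E') φ p : E →L[ℝ] E') v) := by
    rw [hinv]
    exact ⟨_, h3, fun v => rfl⟩
  have h5 := (h4.comp _ h1).mfderiv
  have h6 := mfderiv_eq_fderiv (𝕜 := ℝ)
    (f := writtenInExtChartAt 𝓘(ℝ, E) 𝓘(ℝ, E') x φ) (x := extChartAt 𝓘(ℝ, E) x p)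
  exact (ContinuousLinearMap.ext_iff.1 (h6.symm.trans h5) v).trans (hL _)

theorem eventually_intertwining_inChart {φ : M → N}
    (hφ : ContMDiff 𝓘(ℝ, E) 𝓘(ℝ, E') ∞ φ) {T : EndField E M} {S : EndField E' N}
    (h : ∀ x v, mfderiv 𝓘(ℝ, E) 𝓘(ℝ, E') φ x (T x v) =
      S (φ x) (mfderiv 𝓘(ℝ, E) 𝓘(ℝ, E') φ x v)) (x : M) :
    ∀ᶠ u in 𝓝 (extChartAt 𝓘(ℝ, E) x x), ∀ w,
      fderiv ℝ (writtenInExtChartAt 𝓘(ℝ, E) 𝓘(ℝ, E') x φ) u (endInChart T x u w) =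
        endInChart S (φ x) (writtenInExtChartAt 𝓘(ℝ, E) 𝓘(ℝ, E') x φ u)
          (fderiv ℝ (writtenInExtChartAt 𝓘(ℝ, E) 𝓘(ℝ, E') x φ) u w) := by
  have hd : MDifferentiable 𝓘(ℝ, E) 𝓘(ℝ, E') φ := hφ.mdifferentiable (by simp)
  have hc : ContinuousAt (φ ∘ (extChartAt 𝓘(ℝ, E) x).symm) (extChartAt 𝓘(ℝ, E) x x) :=
    hφ.continuous.continuousAt.comp (continuousAt_extChartAt_symm x)
  have hs : (extChartAt 𝓘(ℝ, E') (φ x)).source ∈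
      𝓝 ((φ ∘ (extChartAt 𝓘(ℝ, E) x).symm) (extChartAt 𝓘(ℝ, E) x x)) := by
    rw [Function.comp_apply, extChartAt_to_inv]
    exact extChartAt_source_mem_nhds (φ x)
  filter_upwards [extChartAt_target_mem_nhds (I := 𝓘(ℝ, E)) x, hc hs] with u hu hφu w
  have hp := (extChartAt 𝓘(ℝ, E) x).map_target hu
  rw [mem_preimage, Function.comp_apply] at hφu
  have hw : writtenInExtChartAt 𝓘(ℝ, E) 𝓘(ℝ, E') x φ u =
      extChartAt 𝓘(ℝ, E') (φ x) (φ ((extChartAt 𝓘(ℝ, E) x).symm u)) := rfl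
  rw [hw]
  rw [← (extChartAt 𝓘(ℝ, E) x).right_inv hu]
  -- From here the base point is a variable `p` of `M`, and `u` occurs only as its chart image.
  generalize (extChartAt 𝓘(ℝ, E) x).symm u = p at *
  rw [(extChartAt 𝓘(ℝ, E) x).left_inv hp, fderiv_writtenInExtChartAt (hd p) hp hφu,
    fderiv_writtenInExtChartAt (hd p) hp hφu, endInChart_apply T hp]
  refine Eq.trans ?_ (endInChart_apply S hφu _).symm
  -- On each side a chart differential meets that of its inverse and cancels, which leaves the
  -- intertwining relation at `p`.
  have e1 := mfderiv_extChartAt_symm_apply_mfderiv_extChartAt hp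
  have e2 := mfderiv_extChartAt_symm_apply_mfderiv_extChartAt hφu
  refine congrArg (mfderiv 𝓘(ℝ, E') 𝓘(ℝ, E') (extChartAt 𝓘(ℝ, E') (φ x)) (φ p)) ?_
  refine (congrArg (mfderiv 𝓘(ℝ, E) 𝓘(ℝ, E') φ p) (e1 _)).trans ((h p _).trans ?_)
  exact congrArg (S (φ p)) (e2 _).symm

variable [FiniteDimensional ℝ E] [FiniteDimensional ℝ E']

/-- If `dφ` intertwines two parallel fields of endomorphisms, so does `∇dφ` in its second
argument. -/
theorem secondFundamentalForm_intertwining (g : Metric E M) (h : Metric E' N) {φ : M → N}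
    (hφ : ContMDiff 𝓘(ℝ, E) 𝓘(ℝ, E') ∞ φ) {T : EndField E M} {S : EndField E' N}
    (hT : T.IsSmooth) (hS : S.IsSmooth) (hTpar : IsParallel g T) (hSpar : IsParallel h S)
    (hTS : ∀ x v, dmap φ x (T x v) = S (φ x) (dmap φ x v)) (x : M)
    (v w : TangentSpace 𝓘(ℝ, E) x) :
    secondFundamentalForm g h φ x v (T x w) = S (φ x) (secondFundamentalForm g h φ x v w) := by
  have hf0 : writtenInExtChartAt 𝓘(ℝ, E) 𝓘(ℝ, E') x φ (extChartAt 𝓘(ℝ, E) x x) =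
      extChartAt 𝓘(ℝ, E') (φ x) (φ x) := by
    rw [writtenInExtChartAt, Function.comp_apply, Function.comp_apply, extChartAt_to_inv]
  have key := fderiv_fderiv_apply_of_intertwining (E := E) (E' := E')
    ((contDiffAt_writtenInExtChartAt (hφ x)).of_le (by norm_cast))
    (hT.differentiableAt_endInChart x)
    (by rw [hf0]; exact hS.differentiableAt_endInChart (φ x))
    (eventually_intertwining_inChart hφ hTS x) v w
  rw [hf0, fderiv_writtenInExtChartAt_self (hφ.mdifferentiable (by simp) x), endInChart_self,
    endInChart_self] at key
  have pT := hTpar x v w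
  have pS := hSpar (φ x) (dmap φ x v) (dmap φ x w)
  unfold covDerivEnd at pT pS
  unfold secondFundamentalForm
  -- The target Christoffel term becomes `Γ(dφ v, dφ (T w))`, the one occurring in `∇dφ(v, T w)`.
  rw [← hTS] at pS
  exact map_sub_add_eq_of_parallel (dmap φ x).toLinearMap (S (φ x)).toLinearMap key pT pS (hTS x _)

end Maps

end PHWC

namespace PHWC

/-! ### The second fundamental form as a symmetric bilinear map -/

section SecondFundamentalForm

variable {E : Type*} [NormedAddCommGroup E] [NormedSpace ℝ E] [FiniteDimensional ℝ E]
  {M : Type*} [TopologicalSpace M] [ChartedSpace E M] [IsManifold 𝓘(ℝ, E) ∞ M]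
  {E' : Type*} [NormedAddCommGroup E'] [NormedSpace ℝ E'] [FiniteDimensional ℝ E']
  {N : Type*} [TopologicalSpace N] [ChartedSpace E' N] [IsManifold 𝓘(ℝ, E') ∞ N]

/-- Second derivatives of the smooth chart expression commute, and both connections are
torsion-free. -/
theorem secondFundamentalForm_symm (g : Metric E M) (h : Metric E' N) {φ : M → N}
    (hφ : ContMDiff 𝓘(ℝ, E) 𝓘(ℝ, E') ∞ φ) (x : M) (v w : TangentSpace 𝓘(ℝ, E) x) :
    secondFundamentalForm g h φ x v w = secondFundamentalForm g h φ x w v := by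
  have hs : IsSymmSndFDerivAt ℝ (writtenInExtChartAt 𝓘(ℝ, E) 𝓘(ℝ, E') x φ)
      (extChartAt 𝓘(ℝ, E) x x) :=
    (contDiffAt_writtenInExtChartAt (hφ x)).isSymmSndFDerivAt (by simp; norm_cast)
  unfold secondFundamentalForm
  rw [christoffel_symm g x v w, christoffel_symm h (φ x) (dmap φ x v)]
  exact congrArg (fun d : TangentSpace 𝓘(ℝ, E') (φ x) => d - dmap φ x (christoffel g x w v) +
    christoffel h (φ x) (dmap φ x w) (dmap φ x v)) (hs v w)

theorem secondFundamentalForm_add (g : Metric E M) (h : Metric E' N) (φ : M → N) (x : M)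
    (v w w' : TangentSpace 𝓘(ℝ, E) x) :
    secondFundamentalForm g h φ x v (w + w') =
      secondFundamentalForm g h φ x v w + secondFundamentalForm g h φ x v w' := by
  have aux : ∀ a a' b b' c c' : TangentSpace 𝓘(ℝ, E') (φ x),
      a + a' - (b + b') + (c + c') = a - b + c + (a' - b' + c') := by
    intros
    abel
  unfold secondFundamentalForm
  dsimp only
  rw [christoffel_add, map_add, map_add, christoffel_add]
  set d2φ := fderiv ℝ (fderiv ℝ (writtenInExtChartAt 𝓘(ℝ, E) 𝓘(ℝ, E') x φ))
    (extChartAt 𝓘(ℝ, E) x x)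
  have hd : d2φ v (w + w' : E) = d2φ v w + d2φ v w' := map_add (d2φ v) (w : E) w'
  exact (congrArg (fun d : TangentSpace 𝓘(ℝ, E') (φ x) => d - _ + _) hd).trans
    (aux _ _ _ _ _ _)

theorem secondFundamentalForm_smul (g : Metric E M) (h : Metric E' N) (φ : M → N) (x : M) (r : ℝ)
    (v w : TangentSpace 𝓘(ℝ, E) x) :
    secondFundamentalForm g h φ x v (r • w) = r • secondFundamentalForm g h φ x v w := by
  have aux : ∀ a b c : TangentSpace 𝓘(ℝ, E') (φ x),
      r • a - r • b + r • c = r • (a - b + c) := by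
    intros
    rw [smul_add, smul_sub]
  unfold secondFundamentalForm
  dsimp only
  rw [christoffel_smul, map_smul, map_smul, christoffel_smul]
  set d2φ := fderiv ℝ (fderiv ℝ (writtenInExtChartAt 𝓘(ℝ, E) 𝓘(ℝ, E') x φ))
    (extChartAt 𝓘(ℝ, E) x x)
  have hd : d2φ v (r • w : E) = r • d2φ v w := map_smul (d2φ v) r (w : E)
  exact (congrArg (fun d : TangentSpace 𝓘(ℝ, E') (φ x) => d - _ + _) hd).trans (aux _ _ _)

/-- The second fundamental form of a smooth map as a bilinear map. -/
noncomputable def secondFundamentalFormBilin (g : Metric E M) (h : Metric E' N) {φ : M → N}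
    (hφ : ContMDiff 𝓘(ℝ, E) 𝓘(ℝ, E') ∞ φ) (x : M) :
    TangentSpace 𝓘(ℝ, E) x →ₗ[ℝ] TangentSpace 𝓘(ℝ, E) x →ₗ[ℝ] TangentSpace 𝓘(ℝ, E') (φ x) :=
  LinearMap.mk₂ ℝ (secondFundamentalForm g h φ x)
    -- Linearity in the first slot is obtained from the second by symmetry.
    (fun v v' w => by
      simp only [fun u => secondFundamentalForm_symm g h hφ x u w, secondFundamentalForm_add])
    (fun r v w => by
      simp only [fun u => secondFundamentalForm_symm g h hφ x u w, secondFundamentalForm_smul])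
    (secondFundamentalForm_add g h φ x)
    (fun r v w => secondFundamentalForm_smul g h φ x r v w)

end SecondFundamentalForm

end PHWC

theorem mainTheorem4
    {E : Type*} [NormedAddCommGroup E] [NormedSpace ℝ E] [FiniteDimensional ℝ E]
    {M : Type*} [TopologicalSpace M] [ChartedSpace E M] [IsManifold 𝓘(ℝ, E) ∞ M]
    {E' : Type*} [NormedAddCommGroup E'] [NormedSpace ℝ E'] [FiniteDimensional ℝ E']
    {N : Type*} [TopologicalSpace N] [ChartedSpace E' N] [IsManifold 𝓘(ℝ, E') ∞ N]
    (g : PHWC.Metric E M) (h : PHWC.Metric E' N)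
    (J : PHWC.AlmostHermitianStructure h) (hJ : J.IsKaehler)
    (φ : M → N) (hφ : ContMDiff 𝓘(ℝ, E) 𝓘(ℝ, E') ∞ φ)
    (hne : ∃ x y, φ x ≠ φ y)
    (hphwc : PHWC.IsPHWC g J φ)
    (hF : PHWC.IsFStructure g (PHWC.associatedFStructure hphwc))
    (hpar : PHWC.IsParallel g (PHWC.associatedFStructure hphwc)) :
    PHWC.IsHarmonic g h φ := by
  intro x
  have hFJ : ∀ x v, PHWC.dmap φ x (PHWC.associatedFStructure hphwc x v) =
      J.J (φ x) (PHWC.dmap φ x v) := fun x v =>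
    (PHWC.isAssociatedAt_associatedFStructure hphwc x).comp_eq (J.sq (φ x)) v
  exact PHWC.sum_eq_zero_of_intertwining (Module.finBasis ℝ (TangentSpace 𝓘(ℝ, E) x))
    (g := g.bilin x) (F := (PHWC.associatedFStructure hphwc x).toLinearMap)
    (J := (J.J (φ x)).toLinearMap)
    -- The trace lemma uses the algebraic dual and `sharp` the continuous one; in finite dimension
    -- they are identified.
    ((g.sharp x).toLinearMap ∘ₗ LinearMap.toContinuousLinearMap.toLinearMap)
    (fun ξ v => g.inner_sharp x (LinearMap.toContinuousLinearMap ξ) v)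
    (fun v w hvw => g.inner_injective x (ContinuousLinearMap.coe_injective hvw))
    (hF.isFStructureAt x).skew (J.sq (φ x)) (PHWC.secondFundamentalFormBilin g h hφ x)
    (PHWC.secondFundamentalForm_symm g h hφ x)
    (PHWC.secondFundamentalForm_intertwining g h hφ hF.smooth J.smooth hpar hJ hFJ x)
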